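/- **Theorem.** Let $\pi: E \to B$ be a diffeological bundle, i.e. a smooth map of diffeological spaces for which there is a diffeological space $F_0$ such that for every plot $p: U \to B$ ($U$ open in some $\mathbb{R}^n$) the pullback of $\pi$ along $p$ is locally trivial with fiber $F_0$: every point of $U$ has an open neighbourhood $V \subseteq U$ such that $\{(v,y) \in V \times E : p(v) = \pi(y)\}$ is diffeomorphic over $V$ to $V \times F_0$. Let $e \in E$ and $b = \pi(e)$, and let $\iota : F \to E$ be the inclusion of the fiber $F = \pi^{-1}(b)$, equipped with the sub-diffeology. For a pointed diffeological space $(X,x)$, let $T_x(X)$ be the internal tangent space: the colimit of the vector spaces $T_0(U)$ over the category of pointed plots $p : (U,0) \to (X,x)$, with $U$ a connected open neighbourhood of $0$ in some $\mathbb{R}^n$, whose morphisms are the smooth maps of the domains that preserve $0$ and commute with the plots. Then $$T_e(F) \xrightarrow{\ \iota_*\ } T_e(E) \xrightarrow{\ \pi_*\ } T_b(B) \longrightarrow 0$$ is an exact sequence of real vector spaces. Moreover, let $T^H X$ be the set $\coprod_{x \in X} T_x(X)$ with Hector's diffeology, i.e. the diffeology generated by the maps $Tp : TU = U \times \mathbb{R}^n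 \to \coprod_{x} T_x(X)$ induced by the plots $p : U \to X$, and let $T^{dvs} X$ be the same set with the smallest diffeology that contains Hector's diffeology and makes it a diffeological vector space over $X$ (the projection to $X$, the zero section, fiberwise addition and scalar multiplication are smooth). Let $T^H_x(X)$ and $T^{dvs}_x(X)$ denote $T_x(X)$ with the sub-diffeologies of $T^H X$ and $T^{dvs} X$. Then both $$\pi_*: T^H_e(E) \to T^H_b(B) \qquad\text{and}\qquad \pi_*: T^{dvs}_e(E) \to T^{dvs}_b(B)$$ are subductions, i.e. the plots of the target are exactly the functions that locally lift along $\pi_*$ to plots of the source. -/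

import Mathlib

open Diffeology
open scoped ContDiff

noncomputable section

namespace Diffeology

universe u v w

/-- The Euclidean space `ℝⁿ`. Mathlib gives it the standard diffeology. -/
abbrev Euc (n : ℕ) : Type := EuclideanSpace ℝ (Fin n)

section Constructions

variable {X : Type u} {Y : Type v}

/-- The pullback diffeology along `f`: a map `p` is a plot iff `f ∘ p` is a plot. -/
@[reducible]
def inducedDiffeology (d : DiffeologicalSpace Y) (f : X → Y) : DiffeologicalSpace X where
  plots _ := {p | IsPlot (f ∘ p)}
  constant_plots x := isPlot_const (x := f x)
  plot_reparam hp hf := isPlot_reparam hp hf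
  locality h := DiffeologicalSpace.locality h

/-- The sub-diffeology on a subset. -/
instance instDiffeologicalSpaceSubtype [d : DiffeologicalSpace X] (P : X → Prop) :
    DiffeologicalSpace {x : X // P x} :=
  inducedDiffeology d Subtype.val

/-- The product diffeology: a map is a plot iff both of its components are plots. -/
instance instDiffeologicalSpaceProd [d₁ : DiffeologicalSpace X] [d₂ : DiffeologicalSpace Y] :
    DiffeologicalSpace (X × Y) where
  plots _ := {p | IsPlot (Prod.fst ∘ p) ∧ IsPlot (Prod.snd ∘ p)}
  constant_plots z := ⟨isPlot_const (x := z.1), isPlot_const (x := z.2)⟩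
  plot_reparam hp hf := ⟨isPlot_reparam hp.1 hf, isPlot_reparam hp.2 hf⟩
  locality h :=
    ⟨DiffeologicalSpace.locality fun x =>
        let ⟨U, hU, hx, hp⟩ := h x
        ⟨U, hU, hx, fun hf hs => (hp hf hs).1⟩,
      DiffeologicalSpace.locality fun x =>
        let ⟨U, hU, hx, hp⟩ := h x
        ⟨U, hU, hx, fun hf hs => (hp hf hs).2⟩⟩

lemma dSmooth_subtype_val [DiffeologicalSpace X] (P : X → Prop) :
    DSmooth (Subtype.val : {x : X // P x} → X) :=
  fun _ _ hp => hp

/-- A diffeomorphism: a bijection that is smooth in both directions. -/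
structure Diffeomorphism (X : Type u) (Y : Type v) [DiffeologicalSpace X]
    [DiffeologicalSpace Y] extends X ≃ Y where
  smooth_toFun : DSmooth toFun
  smooth_invFun : DSmooth invFun

/-- A subduction: the plots of `Y` are exactly the maps that locally lift along `f` to plots of
`X`. Here a map on an open subset `V` of a Euclidean space is a plot iff it is smooth for the
sub-diffeology of `V`. -/
def IsSubduction [DiffeologicalSpace X] [DiffeologicalSpace Y] (f : X → Y) : Prop :=
  ∀ (n : ℕ) (p : Euc n → Y), IsPlot p ↔
    ∀ t : Euc n, ∃ V : Set (Euc n), IsOpen V ∧ t ∈ V ∧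
      ∃ q : V → X, DSmooth q ∧ ∀ s : V, f (q s) = p s

/-- The pullback of `f : X → Y` along `p : U → Y`, as a subspace of `U × X`. -/
abbrev Pullback {U : Type w} (p : U → Y) (f : X → Y) : Type (max w u) :=
  {z : U × X // p z.1 = f z.2}

/-- `f : X → Y` is a diffeological bundle with fiber `F`: it is smooth, and for every plot
`p : U → Y`, with `U` an open subset of a Euclidean space, the pullback of `f` along `p` is locally
trivial with fiber `F`: around each point of `U` there is an open `V ⊆ U` such that the restriction
of the pullback to `V` is diffeomorphic, over `V`, to `V × F`. -/
structure IsDiffeologicalBundle (F : Type w) [DiffeologicalSpace F] [DiffeologicalSpace X]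
    [DiffeologicalSpace Y] (f : X → Y) : Prop where
  smooth : DSmooth f
  locally_trivial : ∀ (n : ℕ) (U : Set (Euc n)), IsOpen U → ∀ p : U → Y, DSmooth p →
    ∀ t ∈ U, ∃ (V : Set (Euc n)) (hVU : V ⊆ U), IsOpen V ∧ t ∈ V ∧
      ∃ φ : Diffeomorphism (Pullback (p ∘ Set.inclusion hVU) f) (V × F),
        ∀ z, (φ.toEquiv z).1 = z.1.1

end Constructions

/-! ### The internal tangent space -/

/-- A plot of `X` centered at `x`, whose domain is a connected open neighbourhood of `0`. -/
structure PointedPlot (X : Type u) [DiffeologicalSpace X] (x : X) where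
  dim : ℕ
  dom : Set (Euc dim)
  isOpen_dom : IsOpen dom
  isConnected_dom : IsConnected dom
  zero_mem : (0 : Euc dim) ∈ dom
  toFun : dom → X
  smooth : DSmooth toFun
  map_zero : toFun ⟨0, zero_mem⟩ = x

namespace PointedPlot

variable {X : Type u} {Y : Type v} [DiffeologicalSpace X] [DiffeologicalSpace Y] {x : X}

/-- `f`, restricted to the domain of `p`, is a morphism `p ⟶ q` in the category of plots of `X`
centered at `x`: a smooth map of the domains that fixes `0` and commutes with the maps to `X`.
The values of `f` outside the domain of `p` play no role. -/
structure IsHom (p q : PointedPlot X x) (f : Euc p.dim → Euc q.dim) : Prop where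
  contDiffOn : ContDiffOn ℝ ∞ f p.dom
  mapsTo : Set.MapsTo f p.dom q.dom
  map_zero : f 0 = 0
  comm : ∀ s : p.dom, q.toFun ⟨f s, mapsTo s.2⟩ = p.toFun s

/-- The composite of a pointed plot with a smooth map. -/
def map (f : X → Y) (hf : DSmooth f) (p : PointedPlot X x) : PointedPlot Y (f x) where
  dim := p.dim
  dom := p.dom
  isOpen_dom := p.isOpen_dom
  isConnected_dom := p.isConnected_dom
  zero_mem := p.zero_mem
  toFun := f ∘ p.toFun
  smooth := hf.comp p.smooth
  map_zero := congrArg f p.map_zero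

lemma IsHom.map {p q : PointedPlot X x} {g : Euc p.dim → Euc q.dim} (hg : IsHom p q g)
    (f : X → Y) (hf : DSmooth f) : IsHom (p.map f hf) (q.map f hf) g where
  contDiffOn := hg.contDiffOn
  mapsTo := hg.mapsTo
  map_zero := hg.map_zero
  comm s := congrArg f (hg.comm s)

/-- A plot `p : U → X` on a connected open set, translated so that it is centered at `p t`. -/
def translate {n : ℕ} {U : Set (Euc n)} (hU : IsOpen U) (hUc : IsConnected U) (p : U → X)
    (hp : DSmooth p) (t : U) : PointedPlot X (p t) where
  dim := n
  dom := {s | (t : Euc n) + s ∈ U}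
  isOpen_dom := hU.preimage (continuous_const.add continuous_id)
  isConnected_dom := by
    have h : {s : Euc n | (t : Euc n) + s ∈ U} = (Homeomorph.addLeft (t : Euc n)) ⁻¹' U := rfl
    rw [h]
    exact (Homeomorph.isConnected_preimage _).2 hUc
  zero_mem := by simp
  toFun s := p ⟨(t : Euc n) + s, s.2⟩
  smooth := by
    intro m q hq
    have hq' : IsPlot (fun r : Euc m => (q r : Euc n)) := hq
    exact hp m (fun r => ⟨(t : Euc n) + q r, (q r).2⟩)
      (show IsPlot (fun r : Euc m => (t : Euc n) + (q r : Euc n)) from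
        (contDiff_const.add hq'.contDiff).isPlot)
  map_zero := congrArg p (Subtype.ext (add_zero _))

end PointedPlot

section Tangent

open scoped Classical in
/-- The vector in the direct sum `⨁ₚ T₀(dom p)` over all pointed plots with the single
component `v` at `p`; here `T₀(dom p) = ℝⁿ`. -/
def singleVec {X : Type u} [DiffeologicalSpace X] {x : X} (p : PointedPlot X x) :
    Euc p.dim →ₗ[ℝ] DirectSum (PointedPlot X x) (fun q => Euc q.dim) :=
  DirectSum.lof ℝ (PointedPlot X x) (fun q => Euc q.dim) p

/-- The relations that define the colimit: a vector `v` at `p` is identified with the vector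
`T₀f (v)` at `q` for each morphism `f : p ⟶ q` of pointed plots. -/
def tangentRelations (X : Type u) [DiffeologicalSpace X] (x : X) :
    Submodule ℝ (DirectSum (PointedPlot X x) (fun q => Euc q.dim)) :=
  Submodule.span ℝ {z | ∃ (p q : PointedPlot X x) (f : Euc p.dim → Euc q.dim) (v : Euc p.dim),
    p.IsHom q f ∧ z = singleVec p v - singleVec q (fderiv ℝ f 0 v)}

/-- The internal tangent space `T_x(X)`: the colimit of the vector spaces `T₀(dom p)` over the
category of plots `p` of `X` centered at `x`, as a quotient of their direct sum. -/
abbrev TangentSpaceAt (X : Type u) [DiffeologicalSpace X] (x : X) : Type u :=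
  DirectSum (PointedPlot X x) (fun q => Euc q.dim) ⧸ tangentRelations X x

variable {X : Type u} {Y : Type v} [DiffeologicalSpace X] [DiffeologicalSpace Y]

/-- The tangent vector `p_*(v)`, for a plot `p` centered at `x` and `v ∈ T₀(dom p)`; these are the
structure maps of the colimit. -/
def pushVec {x : X} (p : PointedPlot X x) : Euc p.dim →ₗ[ℝ] TangentSpaceAt X x :=
  (tangentRelations X x).mkQ.comp (singleVec p)

lemma pushVec_fderiv {x : X} {p q : PointedPlot X x} {f : Euc p.dim → Euc q.dim}
    (hf : p.IsHom q f) (v : Euc p.dim) : pushVec q (fderiv ℝ f 0 v) = pushVec p v :=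
  ((Submodule.Quotient.eq (tangentRelations X x)).2
    (show singleVec p v - singleVec q (fderiv ℝ f 0 v) ∈ tangentRelations X x from
      Submodule.subset_span ⟨p, q, f, v, hf, rfl⟩)).symm

open scoped Classical in
/-- The linear map out of the colimit `T_x(X)` given by a cocone. -/
def tangentDesc {x : X} {M : Type w} [AddCommGroup M] [Module ℝ M]
    (c : ∀ p : PointedPlot X x, Euc p.dim →ₗ[ℝ] M)
    (hc : ∀ (p q : PointedPlot X x) (f : Euc p.dim → Euc q.dim), p.IsHom q f →
      ∀ v, c q (fderiv ℝ f 0 v) = c p v) : TangentSpaceAt X x →ₗ[ℝ] M :=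
  (tangentRelations X x).liftQ (DirectSum.toModule ℝ (PointedPlot X x) M c) <| by
    refine Submodule.span_le.2 ?_
    rintro _ ⟨p, q, f, v, hf, rfl⟩
    simp [singleVec, DirectSum.toModule_lof, hc p q f hf v]

lemma tangentDesc_pushVec {x : X} {M : Type w} [AddCommGroup M] [Module ℝ M]
    (c : ∀ p : PointedPlot X x, Euc p.dim →ₗ[ℝ] M)
    (hc : ∀ (p q : PointedPlot X x) (f : Euc p.dim → Euc q.dim), p.IsHom q f →
      ∀ v, c q (fderiv ℝ f 0 v) = c p v) (p : PointedPlot X x) (v : Euc p.dim) :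
    tangentDesc c hc (pushVec p v) = c p v := by
  classical
  change DirectSum.toModule ℝ (PointedPlot X x) M c (singleVec p v) = c p v
  simp [singleVec, DirectSum.toModule_lof]

lemma tangent_hom_ext {x : X} {M : Type w} [AddCommGroup M] [Module ℝ M]
    {g h : TangentSpaceAt X x →ₗ[ℝ] M}
    (H : ∀ (p : PointedPlot X x) (v : Euc p.dim), g (pushVec p v) = h (pushVec p v)) : g = h := by
  classical
  refine Submodule.linearMap_qext _ (DirectSum.linearMap_ext ℝ fun p => LinearMap.ext fun v => ?_)
  have := H p v
  simp only [pushVec, singleVec, LinearMap.comp_apply] at this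
  simp only [LinearMap.comp_apply]
  convert this

/-- The linear map `f_* : T_x(X) → T_{f(x)}(Y)` induced by a smooth map `f`, which sends `p_*(v)`
to `(f ∘ p)_*(v)`. -/
def tangentMap (f : X → Y) (hf : DSmooth f) (x : X) :
    TangentSpaceAt X x →ₗ[ℝ] TangentSpaceAt Y (f x) :=
  tangentDesc (fun p => pushVec (p.map f hf)) fun _ _ _ hg v => pushVec_fderiv (hg.map f hf) v

lemma tangentMap_pushVec (f : X → Y) (hf : DSmooth f) {x : X} (p : PointedPlot X x)
    (v : Euc p.dim) : tangentMap f hf x (pushVec p v) = pushVec (p.map f hf) v :=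
  tangentDesc_pushVec _ _ p v

end Tangent

/-! ### The internal tangent bundle and its two diffeologies -/

section Bundle

variable (X : Type u) [DiffeologicalSpace X]

/-- The internal tangent bundle, the disjoint union of the internal tangent spaces. -/
abbrev TangentTotal : Type u := Σ x : X, TangentSpaceAt X x

variable {X} in
/-- The map `Tp : TU = U × ℝⁿ → TX` induced by a plot `p : U → X` on a connected open set. -/
def plotTangent {n : ℕ} {U : Set (Euc n)} (hU : IsOpen U) (hUc : IsConnected U) (p : U → X)
    (hp : DSmooth p) (z : U × Euc n) : TangentTotal X :=
  ⟨p z.1, pushVec (PointedPlot.translate hU hUc p hp z.1) z.2⟩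

/-- Hector's diffeology on the internal tangent bundle: the diffeology generated by the maps
`Tp : TU → TX` for the plots `p : U → X` of `X`, that is, the smallest diffeology for which these
are smooth. It suffices to take connected `U`, as smoothness is local and an open set is the union
of its open connected components. -/
@[reducible]
def hectorDiffeology : DiffeologicalSpace (TangentTotal X) :=
  sInf {d | ∀ (n : ℕ) (U : Set (Euc n)) (hU : IsOpen U) (hUc : IsConnected U) (p : U → X)
    (hp : DSmooth p), @DSmooth _ _ _ d (plotTangent hU hUc p hp)}

/-- The diffeology `d` on the total space of a family `V` of vector spaces makes it into a
diffeological vector space over `X`: the projection, the fiberwise addition on the fiber product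
over `X`, the scalar multiplication and the zero section are smooth. The fiber product is written
as `Σ x, V x × V x`, with the sub-diffeology of the product of two copies of the total space. -/
structure IsDVSOver {X : Type u} [DiffeologicalSpace X] (V : X → Type v)
    [∀ x, AddCommGroup (V x)] [∀ x, Module ℝ (V x)] (d : DiffeologicalSpace (Σ x, V x)) :
    Prop where
  smooth_proj : DSmooth (Sigma.fst : (Σ x, V x) → X)
  smooth_add : @DSmooth (Σ x, V x × V x) (Σ x, V x)
    (inducedDiffeology (instDiffeologicalSpaceProd (d₁ := d) (d₂ := d))
      fun z => ((⟨z.1, z.2.1⟩ : Σ x, V x), (⟨z.1, z.2.2⟩ : Σ x, V x))) d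
    fun z => ⟨z.1, z.2.1 + z.2.2⟩
  smooth_smul : DSmooth (fun z : ℝ × (Σ x, V x) => (⟨z.2.1, z.1 • z.2.2⟩ : Σ x, V x))
  smooth_zero : DSmooth (fun x : X => (⟨x, 0⟩ : Σ x, V x))

/-- The dvs diffeology on the internal tangent bundle: the smallest diffeology that contains
Hector's diffeology and makes the bundle into a diffeological vector space over `X`. -/
@[reducible]
def dvsDiffeology : DiffeologicalSpace (TangentTotal X) :=
  sInf {d | hectorDiffeology X ≤ d ∧ IsDVSOver (TangentSpaceAt X) d}

/-- The diffeology of `T^H_x(X)`: the sub-diffeology of Hector's diffeology on the fiber. -/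
@[reducible]
def hectorFiber (x : X) : DiffeologicalSpace (TangentSpaceAt X x) :=
  inducedDiffeology (hectorDiffeology X) fun v => (⟨x, v⟩ : TangentTotal X)

/-- The diffeology of `T^dvs_x(X)`: the sub-diffeology of the dvs diffeology on the fiber. -/
@[reducible]
def dvsFiber (x : X) : DiffeologicalSpace (TangentSpaceAt X x) :=
  inducedDiffeology (dvsDiffeology X) fun v => (⟨x, v⟩ : TangentTotal X)

end Bundle

end Diffeology

end

/-!
Smooth bump functions give smooth maps `χ : ℝⁿ → U` into any neighbourhood `U` of `t` that are the
identity near `t` (`exists_contDiff_eventuallyEq_id`). Precomposing with them replaces plots on open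
sets by plots on all of `ℝⁿ` with the same germ, and tangent vectors depend only on germs. So
everything can be expressed through the vectors `TP (t, v)` of plots `P : ℝⁿ → X` (`plotVec`), which
obey the chain rule `plotVec_eq` and span the tangent spaces (`tangent_induction`). Near `t`, a
local trivialization of the bundle along a plot `p` of `B` becomes a family of points `ψ s y` of `E`
over `p s`, with a fiber coordinate `γ` (`IsDiffeologicalBundle.exists_trivialization`).

*Exactness.* A plot of `B` through `π e` has the lift `s ↦ ψ s (γ t e)` through `e`, so `π_*` is
surjective. Any other lift has the form `s ↦ ψ s (g s)`, the diagonal of `(s, r) ↦ ψ s (g r)`, so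
its velocity is that of the lift `s ↦ ψ s (g 0)` plus that of the curve `r ↦ ψ 0 (g r)` in the fiber
(`plotVec_sub_mem_range`). Thus lifting is well defined modulo the image of `ι_*` and gives a map
`T_b(B) → T_e(E) / im ι_*` whose composite with `π_*` is the quotient map
(`IsDiffeologicalBundle.exists_leftInverse`); hence `ker π_* ⊆ im ι_*`.

*Subductions.* Plots of Hector's diffeology are locally constant or of the form `TP (u s, w s)`, and
plots of the dvs diffeology are locally finite sums of the latter along a plot of the base
(`hectorDiffeology_le`, `dvsDiffeology_le`). If all `P (u s)` are the point `π e`, the plot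
`(s, x) ↦ ψ x (γ (u s) e)` sends each `(s, u s)` to `e`, and its vectors `(0, w s)` at these points
lift `TP (u s, w s)` (`IsDiffeologicalBundle.exists_isElementary_lift`). Constants lift by
surjectivity, and sums lift term by term.
-/

noncomputable section

namespace Diffeology

open Filter Topology

universe u v w

/-! ### Germs of plots and their tangent vectors -/

section Germs

/-- A bump function contracts `ℝⁿ` into a given neighbourhood of `t` without changing the germ of
the identity at `t`. Composing with such a map turns a plot on an open set into a plot on all of
`ℝⁿ` with the same germ at `t`. -/
lemma exists_contDiff_eventuallyEq_id {n : ℕ} {U : Set (Euc n)} {t : Euc n} (hU : U ∈ 𝓝 t) :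
    ∃ χ : Euc n → Euc n, ContDiff ℝ ∞ χ ∧ (∀ s, χ s ∈ U) ∧ χ =ᶠ[𝓝 t] id := by
  obtain ⟨ε, hε, hεU⟩ := Metric.nhds_basis_ball.mem_iff.1 hU
  let β : ContDiffBump t := ⟨ε / 2, ε, by positivity, by linarith⟩
  refine ⟨fun s => t + β s • (s - t),
    contDiff_const.add (β.contDiff.smul (contDiff_id.sub contDiff_const)), fun s => hεU ?_, ?_⟩
  · by_cases hs : dist s t < ε
    · have h1 : ‖β s • (s - t)‖ ≤ 1 * ‖s - t‖ := by
        rw [norm_smul, Real.norm_of_nonneg β.nonneg]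
        gcongr
        exact β.le_one
      rw [mem_ball_iff_norm, add_sub_cancel_left]
      rw [dist_eq_norm] at hs
      linarith
    · have : β s = 0 := β.zero_of_le_dist (not_lt.1 hs)
      simpa [this] using hε
  · filter_upwards [β.eventuallyEq_one] with s hs
    simp [hs]

variable {X : Type u} [DiffeologicalSpace X]

/-- Being a plot depends only on the germs of a map. -/
lemma isPlot_of_eventuallyEq {n : ℕ} {p : Euc n → X}
    (h : ∀ t, ∃ q : Euc n → X, IsPlot q ∧ p =ᶠ[𝓝 t] q) : IsPlot p := by
  refine DiffeologicalSpace.locality fun t => ?_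
  obtain ⟨q, hq, hpq⟩ := h t
  obtain ⟨U, hUs, hU, ht⟩ := mem_nhds_iff.1 hpq
  refine ⟨U, hU, ht, fun {m f} hf hfs => ?_⟩
  have : p ∘ f = q ∘ f := funext fun s => hUs (hf s)
  rw [this]
  exact isPlot_reparam hq hfs

lemma isPlot_comp_of_mem {n m : ℕ} {V : Set (Euc n)} {q : V → X} (hq : DSmooth q)
    {f : Euc m → Euc n} (hf : ContDiff ℝ ∞ f) (hfV : ∀ s, f s ∈ V) :
    IsPlot fun s => q ⟨f s, hfV s⟩ :=
  hq m (fun s => ⟨f s, hfV s⟩) hf.isPlot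

lemma isSubduction_of_lift {Y : Type v} [DiffeologicalSpace Y] {f : X → Y} (hf : DSmooth f)
    (h : ∀ (n : ℕ) (p : Euc n → Y), IsPlot p → ∀ t,
      ∃ q : Euc n → X, IsPlot q ∧ ∀ᶠ s in 𝓝 t, f (q s) = p s) : IsSubduction f := by
  refine fun n p => ⟨fun hp t => ?_, fun hp => DiffeologicalSpace.locality fun t => ?_⟩
  · obtain ⟨q, hq, hqp⟩ := h n p hp t
    obtain ⟨V, hVs, hV, ht⟩ := mem_nhds_iff.1 hqp
    exact ⟨V, hV, ht, fun s => q s, hq.dSmooth.comp (dSmooth_subtype_val _), fun s => hVs s.2⟩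
  · obtain ⟨V, hV, ht, q, hq, hqp⟩ := hp t
    refine ⟨V, hV, ht, fun {m g} hg hgs => ?_⟩
    have : p ∘ g = fun s => f (q ⟨g s, hg s⟩) := funext fun s => (hqp ⟨g s, hg s⟩).symm
    rw [this]
    exact hf m _ (isPlot_comp_of_mem hq hgs hg)

end Germs

section TangentVectors

variable {X : Type u} [DiffeologicalSpace X]

/-- The plot `P : ℝⁿ → X`, translated so that it is centered at `P t`. The base point is a separate
argument `x` with a proof of `P t = x`, so that vectors coming from different plots can be compared
in the same tangent space. -/
def centeredPlot {n : ℕ} (P : Euc n → X) (hP : IsPlot P) (t : Euc n) {x : X} (h : P t = x) :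
    PointedPlot X x where
  dim := n
  dom := Set.univ
  isOpen_dom := isOpen_univ
  isConnected_dom := isConnected_univ
  zero_mem := trivial
  toFun s := P (t + s)
  smooth := by
    intro m q hq
    have hq' : IsPlot (fun r : Euc m => (q r : Euc n)) := hq
    exact isPlot_reparam hP (f := fun r => t + (q r : Euc n)) (contDiff_const.add hq'.contDiff)
  map_zero := by simpa using h

/-- The tangent vector `TP (t, v)` at `x = P t`, for a plot `P : ℝⁿ → X` and `v ∈ T_t(ℝⁿ) = ℝⁿ`. -/
def plotVec {n : ℕ} (P : Euc n → X) (hP : IsPlot P) (t : Euc n) {x : X} (h : P t = x) :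
    Euc n →ₗ[ℝ] TangentSpaceAt X x :=
  pushVec (centeredPlot P hP t h)

/-- The defining relation of the colimit, for a morphism `g` from a translated plot on `ℝⁿ` to an
arbitrary pointed plot. -/
lemma plotVec_eq_pushVec {n : ℕ} {P : Euc n → X} (hP : IsPlot P) {t : Euc n} {x : X} (h : P t = x)
    (q : PointedPlot X x) {g : Euc n → Euc q.dim} (hg : ContDiff ℝ ∞ g)
    (hgq : ∀ s, g s ∈ q.dom) (hg0 : g 0 = 0) (hgP : ∀ s, q.toFun ⟨g s, hgq s⟩ = P (t + s))
    {D : Euc n →L[ℝ] Euc q.dim} (hD : HasFDerivAt g D 0) (v : Euc n) :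
    plotVec P hP t h v = pushVec q (D v) := by
  have hom : (centeredPlot P hP t h).IsHom q g := ⟨hg.contDiffOn, fun s _ => hgq s, hg0,
    fun s => hgP s.1⟩
  have h1 : fderiv ℝ g 0 = D := hD.fderiv
  have h2 : pushVec q (fderiv ℝ g 0 v) = plotVec P hP t h v := pushVec_fderiv hom v
  rw [← h2, h1]

lemma plotVec_comp {n m : ℕ} {P : Euc n → X} (hP : IsPlot P) {f : Euc m → Euc n}
    (hf : ContDiff ℝ ∞ f) (hQ : IsPlot (P ∘ f)) {t : Euc m} {y : Euc n} (hy : f t = y)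
    {D : Euc m →L[ℝ] Euc n} (hD : HasFDerivAt f D t) {x : X} (h : P (f t) = x) (h' : P y = x)
    (v : Euc m) : plotVec (P ∘ f) hQ t h v = plotVec P hP y h' (D v) := by
  subst hy
  have hg : HasFDerivAt (fun s => f (t + s) - f t) D 0 := by
    have h0 : HasFDerivAt f D (t + 0) := by simpa using hD
    exact ((hasFDerivAt_comp_add_left t).2 h0).sub_const (f t)
  exact plotVec_eq_pushVec hQ h (centeredPlot P hP (f t) h')
    ((hf.comp (contDiff_const.add contDiff_id)).sub contDiff_const) (fun _ => trivial)
    (show f (t + 0) - f t = 0 by simp)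
    (fun s => congrArg P (add_sub_cancel (f t) (f (t + s)))) hg v

lemma plotVec_comp_of_eventuallyEq_id {n : ℕ} {P : Euc n → X} (hP : IsPlot P)
    {χ : Euc n → Euc n} (hχ : ContDiff ℝ ∞ χ) {t : Euc n} (hχt : χ =ᶠ[𝓝 t] id)
    (hQ : IsPlot (P ∘ χ)) {x : X} (h : P (χ t) = x) (h' : P t = x) (v : Euc n) :
    plotVec (P ∘ χ) hQ t h v = plotVec P hP t h' v :=
  plotVec_comp hP hχ hQ hχt.eq_of_nhds
    ((hasFDerivAt_id t).congr_of_eventuallyEq hχt) h h' v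

/-- The chain rule: if `Q = P ∘ f` near `t`, then `TQ (t, v) = TP (f t, Df_t v)`. -/
lemma plotVec_eq {n m : ℕ} {P : Euc n → X} (hP : IsPlot P) {Q : Euc m → X} (hQ : IsPlot Q)
    {f : Euc m → Euc n} (hf : ContDiff ℝ ∞ f) {t : Euc m} {y : Euc n} (hy : f t = y)
    {D : Euc m →L[ℝ] Euc n} (hD : HasFDerivAt f D t) (hPQ : Q =ᶠ[𝓝 t] P ∘ f)
    {x : X} (h : Q t = x) (h' : P y = x) (v : Euc m) :
    plotVec Q hQ t h v = plotVec P hP y h' (D v) := by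
  obtain ⟨χ, hχ, hχU, hχt⟩ := exists_contDiff_eventuallyEq_id hPQ
  have e1 : Q ∘ χ = P ∘ (f ∘ χ) := funext hχU
  have hχt' : χ t = t := hχt.eq_of_nhds
  have hQχ : IsPlot (Q ∘ χ) := isPlot_reparam hQ hχ
  have k : (Q ∘ χ) t = x := by simpa [hχt'] using h
  rw [← plotVec_comp_of_eventuallyEq_id hQ hχ hχt hQχ k h]
  have aux : ∀ (R : Euc m → X) (hR : IsPlot R) (kR : R t = x), R = P ∘ (f ∘ χ) →
      plotVec R hR t kR v = plotVec P hP y h' (D v) := by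
    rintro R hR kR rfl
    exact plotVec_comp hP (hf.comp hχ) hR (by simp [hχt', hy])
      (hD.congr_of_eventuallyEq (hχt.fun_comp f)) kR h' v
  exact aux _ _ _ e1

lemma plotVec_congr {n : ℕ} {P Q : Euc n → X} (hP : IsPlot P) (hQ : IsPlot Q) {t : Euc n}
    (hPQ : Q =ᶠ[𝓝 t] P) {x : X} (h : Q t = x) (h' : P t = x) (v : Euc n) :
    plotVec Q hQ t h v = plotVec P hP t h' v :=
  plotVec_eq hP hQ contDiff_id rfl (hasFDerivAt_id t) hPQ h h' v

/-- The tangent vectors of a pointed plot depend only on its germ, so they can be computed with a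
plot on all of `ℝⁿ`. -/
lemma pushVec_eq_plotVec {x : X} (p : PointedPlot X x) {P : Euc p.dim → X} (hP : IsPlot P)
    (hPp : ∀ᶠ s in 𝓝 0, ∀ hs : s ∈ p.dom, P s = p.toFun ⟨s, hs⟩) (h : P 0 = x)
    (v : Euc p.dim) : pushVec p v = plotVec P hP 0 h v := by
  obtain ⟨χ, hχ, hχU, hχt⟩ :=
    exists_contDiff_eventuallyEq_id (inter_mem hPp (p.isOpen_dom.mem_nhds p.zero_mem))
  have hχ0 : χ 0 = 0 := hχt.eq_of_nhds
  have hPχ : IsPlot (P ∘ χ) := isPlot_reparam hP hχ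
  have k : (P ∘ χ) 0 = x := by simpa [hχ0] using h
  rw [← plotVec_comp_of_eventuallyEq_id hP hχ hχt hPχ k h]
  exact (plotVec_eq_pushVec hPχ k p hχ (fun s => (hχU s).2) hχ0
    (fun s => ((hχU s).1 (hχU s).2).symm.trans (congrArg (P ∘ χ) (zero_add s).symm))
    ((hasFDerivAt_id (0 : Euc p.dim)).congr_of_eventuallyEq hχt) v).symm

lemma exists_isPlot_extending {n : ℕ} {U : Set (Euc n)} (hU : IsOpen U) {p : U → X}
    (hp : DSmooth p) {t : Euc n} (ht : t ∈ U) :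
    ∃ P : Euc n → X, IsPlot P ∧ ∀ᶠ s in 𝓝 t, ∀ hs : s ∈ U, P s = p ⟨s, hs⟩ := by
  obtain ⟨χ, hχ, hχU, hχt⟩ := exists_contDiff_eventuallyEq_id (hU.mem_nhds ht)
  refine ⟨_, isPlot_comp_of_mem hp hχ hχU, ?_⟩
  filter_upwards [hχt] with s hs hsU
  congr 2

lemma exists_pushVec_eq_plotVec {x : X} (p : PointedPlot X x) :
    ∃ (P : Euc p.dim → X) (hP : IsPlot P) (h : P 0 = x),
      (∀ᶠ s in 𝓝 0, ∀ hs : s ∈ p.dom, P s = p.toFun ⟨s, hs⟩) ∧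
        ∀ v, pushVec p v = plotVec P hP 0 h v := by
  obtain ⟨P, hP, hPp⟩ := exists_isPlot_extending p.isOpen_dom p.smooth p.zero_mem
  have h : P 0 = x := (hPp.self_of_nhds p.zero_mem).trans p.map_zero
  exact ⟨P, hP, h, hPp, pushVec_eq_plotVec p hP hPp h⟩

/-- A constant pointed plot factors through the zero map of its domain, which has derivative `0`. -/
lemma pushVec_eq_zero_of_const {x : X} (p : PointedPlot X x) (hp : ∀ s, p.toFun s = x)
    (v : Euc p.dim) : pushVec p v = 0 := by
  have hom : p.IsHom p (fun _ => 0) :=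
    { contDiffOn := contDiffOn_const
      mapsTo := fun _ _ => p.zero_mem
      map_zero := rfl
      comm := fun s => by rw [hp, hp] }
  rw [← pushVec_fderiv hom v]
  simp

/-- The vectors of pointed plots span the tangent space, although a general element is only a sum
of such vectors. -/
lemma tangent_induction {x : X} {C : TangentSpaceAt X x → Prop} (zero : C 0)
    (push : ∀ (p : PointedPlot X x) (v : Euc p.dim), C (pushVec p v))
    (add : ∀ z w, C z → C w → C (z + w)) (z : TangentSpaceAt X x) : C z := by
  classical
  induction z using Submodule.Quotient.induction_on with
  | _ z =>
    induction z using DirectSum.induction_on with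
    | zero => exact zero
    | of p v =>
      have := push p v
      simp only [pushVec, singleVec, LinearMap.comp_apply, Submodule.mkQ_apply,
        DirectSum.lof_eq_of] at this
      convert this
    | add z w hz hw => exact add _ _ hz hw

lemma tangentMap_plotVec {Y : Type v} [DiffeologicalSpace Y] (f : X → Y) (hf : DSmooth f) {n : ℕ}
    {P : Euc n → X} (hP : IsPlot P) {t : Euc n} {x : X} (h : P t = x)
    (hQ : IsPlot (f ∘ P)) (h' : f (P t) = f x) (v : Euc n) :
    tangentMap f hf x (plotVec P hP t h v) = plotVec (f ∘ P) hQ t h' v :=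
  tangentMap_pushVec f hf (centeredPlot P hP t h) v

end TangentVectors

/-! ### The exact sequence of a diffeological bundle -/

section FiberTangent

variable {E : Type u} {B : Type v} {F₀ : Type w} [DiffeologicalSpace E] [DiffeologicalSpace F₀]
  {π : E → B}

/-- An identification `ℝⁿ⁺ᵐ ≃ ℝⁿ × ℝᵐ`. -/
def eucSum (n m : ℕ) : Euc (n + m) ≃L[ℝ] Euc n × Euc m :=
  ContinuousLinearEquiv.ofFinrankEq (by simp)

/-- The map `ι_* : T_e(F) → T_e(E)` induced by the inclusion of the fiber `F` of `π` through `e`. -/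
abbrev fiberTangentMap (π : E → B) (e : E) :
    TangentSpaceAt {y : E // π y = π e} ⟨e, rfl⟩ →ₗ[ℝ] TangentSpaceAt E e :=
  tangentMap (Subtype.val : {y : E // π y = π e} → E)
    (dSmooth_subtype_val fun y => π y = π e) ⟨e, rfl⟩

/-- A lift `s ↦ ψ s (g s)` has the same velocities, up to vectors tangent to the fiber, as the
lift `s ↦ ψ s (g 0)` which is constant in the fiber direction: it is the diagonal of
`(s, r) ↦ ψ s (g r)`, whose partial derivative in `r` is tangent to the fiber. -/
lemma plotVec_sub_mem_range {e : E} {n : ℕ} {ψ : Euc n → F₀ → E}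
    (hψ : ∀ (m : ℕ) (u : Euc m → Euc n) (g : Euc m → F₀), ContDiff ℝ ∞ u → IsPlot g →
      IsPlot fun s => ψ (u s) (g s)) (hψe : ∀ y, π (ψ 0 y) = π e)
    {g : Euc n → F₀} (hg : IsPlot g) (hq : IsPlot fun s => ψ s (g s))
    (hq₀ : IsPlot fun s => ψ s (g 0)) (h h₀ : ψ 0 (g 0) = e) (v : Euc n) :
    plotVec (fun s => ψ s (g s)) hq 0 h v - plotVec (fun s => ψ s (g 0)) hq₀ 0 h₀ v ∈
      LinearMap.range (fiberTangentMap π e) := by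
  let L := eucSum n n
  have hQ : IsPlot fun z : Euc (n + n) => ψ (L z).1 (g (L z).2) :=
    hψ _ _ _ (contDiff_fst.comp L.contDiff) (isPlot_reparam hg (contDiff_snd.comp L.contDiff))
  have hQ0 : (fun z : Euc (n + n) => ψ (L z).1 (g (L z).2)) 0 = e := by simpa using h
  -- The restrictions of the two-parameter plot to the diagonal and to the two axes.
  have key : ∀ (A : Euc n →L[ℝ] Euc n × Euc n) (q : Euc n → E) (hq : IsPlot q) (h : q 0 = e),
      (∀ s, q s = ψ (A s).1 (g (A s).2)) →
      plotVec q hq 0 h v = plotVec _ hQ 0 hQ0 (L.symm (A v)) := fun A q hq h hqA =>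
    plotVec_eq hQ hq (f := L.symm.toContinuousLinearMap.comp A) (ContinuousLinearMap.contDiff _)
      (map_zero _) (ContinuousLinearMap.hasFDerivAt _)
      (Eventually.of_forall fun s => by simp [hqA]) h hQ0 v
  have hG : IsPlot (fun s : Euc n => (⟨ψ 0 (g s), hψe _⟩ : {y : E // π y = π e})) :=
    hψ n (fun _ => 0) g contDiff_const hg
  refine ⟨plotVec _ hG 0 (Subtype.ext h) v, ?_⟩
  rw [fiberTangentMap, tangentMap_plotVec _ (dSmooth_subtype_val _) hG _
    (hψ n (fun _ => 0) g contDiff_const hg) h]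
  rw [key ((ContinuousLinearMap.id ℝ _).prod (ContinuousLinearMap.id ℝ _)) _ hq h (fun s => rfl),
    key (ContinuousLinearMap.inl ℝ _ _) _ hq₀ h₀ (fun s => rfl),
    key (ContinuousLinearMap.inr ℝ _ _) (Subtype.val ∘ fun s => (⟨ψ 0 (g s), hψe _⟩ :
      {y : E // π y = π e})) hG h (fun s => rfl), ← map_sub, ← map_sub]
  simp

end FiberTangent

section Bundles

variable {E : Type u} {B : Type v} {F₀ : Type w} [DiffeologicalSpace E] [DiffeologicalSpace B]
  [DiffeologicalSpace F₀] {π : E → B}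

/-- A local trivialization, with the base reparametrized by a map `χ` that fixes the germ at `t`:
the pullback of `π` along `p ∘ χ` is parametrized by `(s, y) ↦ ψ s y`, and `γ s z` is the
fiber coordinate of the point `(s, z)` of this pullback. The value of `γ s z` is unspecified if
`π z ≠ p (χ s)`. -/
lemma IsDiffeologicalBundle.exists_trivialization (hπ : IsDiffeologicalBundle F₀ π) {n : ℕ}
    {p : Euc n → B} (hp : IsPlot p) {t : Euc n} {e : E} (he : p t = π e) :
    ∃ (χ : Euc n → Euc n) (ψ : Euc n → F₀ → E) (γ : Euc n → E → F₀),
      ContDiff ℝ ∞ χ ∧ χ =ᶠ[𝓝 t] id ∧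
      (∀ (m : ℕ) (u : Euc m → Euc n) (g : Euc m → F₀), ContDiff ℝ ∞ u → IsPlot g →
        IsPlot fun s => ψ (u s) (g s)) ∧
      (∀ s y, π (ψ s y) = p (χ s)) ∧
      (∀ (m : ℕ) (u : Euc m → Euc n) (q : Euc m → E), ContDiff ℝ ∞ u → IsPlot q →
        (∀ s, p (χ (u s)) = π (q s)) → IsPlot fun s => γ (u s) (q s)) ∧
      ∀ s z, p (χ s) = π z → ψ s (γ s z) = z := by
  classical
  obtain ⟨V, hVU, hV, ht, φ, hφ⟩ := hπ.locally_trivial n Set.univ isOpen_univ (p ∘ Subtype.val)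
    (hp.dSmooth.comp (dSmooth_subtype_val _)) t trivial
  obtain ⟨χ, hχ, hχV, hχt⟩ := exists_contDiff_eventuallyEq_id (hV.mem_nhds ht)
  -- The point `e` over `p t` shows that `F₀` is nonempty, which provides the unspecified values.
  let y₀ : F₀ := (φ.toEquiv ⟨(⟨t, ht⟩, e), he⟩).2
  have hfst : ∀ z : V × F₀, (φ.toEquiv.symm z).1.1 = z.1 := fun z => by
    rw [← hφ, Equiv.apply_symm_apply]
  refine ⟨χ, fun s y => (φ.toEquiv.symm (⟨χ s, hχV s⟩, y)).1.2,
    fun s z => if h : p (χ s) = π z then (φ.toEquiv ⟨(⟨χ s, hχV s⟩, z), h⟩).2 else y₀,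
    hχ, hχt, fun m u g hu hg => ?_, fun s y => ?_, fun m u q hu hq h => ?_, fun s z h => ?_⟩
  · exact (φ.smooth_invFun m (fun s => (⟨χ (u s), hχV (u s)⟩, g s))
      ⟨(hχ.comp hu).isPlot, hg⟩).2
  · have h1 := (φ.toEquiv.symm (⟨χ s, hχV s⟩, y)).2
    have h2 := hfst (⟨χ s, hχV s⟩, y)
    rw [← h1]
    exact congrArg (fun v : V => p v) h2
  · have : (fun s => if h : p (χ (u s)) = π (q s) then
        (φ.toEquiv ⟨(⟨χ (u s), hχV (u s)⟩, q s), h⟩).2 else y₀) =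
        fun s => (φ.toEquiv ⟨(⟨χ (u s), hχV (u s)⟩, q s), h s⟩).2 :=
      funext fun s => dif_pos (h s)
    rw [this]
    exact (φ.smooth_toFun m (fun s => ⟨(⟨χ (u s), hχV (u s)⟩, q s), h s⟩)
      ⟨(hχ.comp hu).isPlot, hq⟩).2
  · simp only [dif_pos h]
    have : ((⟨χ s, hχV s⟩ : V), (φ.toEquiv ⟨(⟨χ s, hχV s⟩, z), h⟩).2) =
        φ.toEquiv ⟨(⟨χ s, hχV s⟩, z), h⟩ := Prod.ext (hφ ⟨(⟨χ s, hχV s⟩, z), h⟩).symm rfl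
    rw [this, Equiv.symm_apply_apply]

lemma IsDiffeologicalBundle.exists_lift (hπ : IsDiffeologicalBundle F₀ π) {n : ℕ}
    {p : Euc n → B} (hp : IsPlot p) {t : Euc n} {e : E} (he : p t = π e) :
    ∃ q : Euc n → E, IsPlot q ∧ q t = e ∧ π ∘ q =ᶠ[𝓝 t] p := by
  obtain ⟨χ, ψ, γ, -, hχt, hψ, hπψ, -, hψγ⟩ := hπ.exists_trivialization hp he
  refine ⟨fun s => ψ s (γ t e), hψ n id _ contDiff_id isPlot_const, hψγ t e ?_, ?_⟩
  · rwa [hχt.eq_of_nhds]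
  · filter_upwards [hχt] with s hs
    simp [hπψ, hs]

/-- Two lifts of the germ of a plot of `B` have the same velocities up to vectors tangent to the
fiber. -/
lemma IsDiffeologicalBundle.mkQ_plotVec_eq (hπ : IsDiffeologicalBundle F₀ π) {e : E} {n : ℕ}
    {q₁ q₂ : Euc n → E} (h₁ : IsPlot q₁) (h₂ : IsPlot q₂) (h : π ∘ q₁ =ᶠ[𝓝 0] π ∘ q₂)
    (e₁ : q₁ 0 = e) (e₂ : q₂ 0 = e) (v : Euc n) :
    (LinearMap.range (fiberTangentMap π e)).mkQ (plotVec q₁ h₁ 0 e₁ v) =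
      (LinearMap.range (fiberTangentMap π e)).mkQ (plotVec q₂ h₂ 0 e₂ v) := by
  obtain ⟨χ, ψ, γ, hχ, hχt, hψ, hπψ, hγ, hψγ⟩ :=
    hπ.exists_trivialization (t := 0) (e := e) (h₁.dSmooth_comp hπ.smooth) (congrArg π e₁)
  have hχ0 : χ 0 = 0 := hχt.eq_of_nhds
  have hψe : ∀ y, π (ψ 0 y) = π e := fun y => by rw [hπψ, hχ0]; exact congrArg π e₁
  have hψ0 : ψ 0 (γ 0 e) = e := hψγ 0 e (by rw [hχ0]; exact congrArg π e₁)
  have hc : IsPlot fun s => ψ s (γ 0 e) := hψ n id _ contDiff_id isPlot_const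
  -- Both velocities agree with that of the lift of constant fiber coordinate.
  have key : ∀ (q : Euc n → E) (hq : IsPlot q) (hqe : q 0 = e), π ∘ q =ᶠ[𝓝 0] π ∘ q₁ →
      plotVec q hq 0 hqe v - plotVec _ hc 0 hψ0 v ∈
      LinearMap.range (fiberTangentMap π e) := by
    intro q hq hqe hqq
    obtain ⟨χ', hχ', hχU, hχt'⟩ := exists_contDiff_eventuallyEq_id
      (inter_mem hqq hχt)
    have hχ0' : χ' 0 = 0 := hχt'.eq_of_nhds
    have hlift : ∀ s, (π ∘ q₁) (χ (χ' s)) = π (q (χ' s)) := fun s => by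
      rw [(hχU s).2]
      exact (hχU s).1.symm
    have hg : IsPlot fun s => γ (χ' s) (q (χ' s)) :=
      hγ n χ' (q ∘ χ') hχ' (isPlot_reparam hq hχ') hlift
    have hg0 : γ (χ' 0) (q (χ' 0)) = γ 0 e := by rw [hχ0', hqe]
    have hq' : IsPlot fun s => ψ s (γ (χ' s) (q (χ' s))) := hψ n id _ contDiff_id hg
    have h0 : ψ 0 (γ (χ' 0) (q (χ' 0))) = e := by rw [hg0, hψ0]
    have h3 := plotVec_sub_mem_range hψ hψe hg hq' (by rw [hg0]; exact hc) h0 h0 v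
    simp only [hg0] at h3
    rw [plotVec_congr hq' hq ?_ hqe h0]
    · exact h3
    · filter_upwards [hχt'] with s hs
      have := hψγ (χ' s) (q (χ' s)) (hlift s)
      rw [hs] at this ⊢
      exact this.symm
  rw [Submodule.mkQ_apply, Submodule.mkQ_apply, Submodule.Quotient.eq]
  have := Submodule.sub_mem _ (key q₁ h₁ e₁ EventuallyEq.rfl) (key q₂ h₂ e₂ h.symm)
  rwa [sub_sub_sub_cancel_right] at this

lemma IsDiffeologicalBundle.exists_lift_pointedPlot (hπ : IsDiffeologicalBundle F₀ π) {e : E}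
    (p : PointedPlot B (π e)) :
    ∃ q : Euc p.dim → E, IsPlot q ∧ q 0 = e ∧
      ∀ᶠ s in 𝓝 0, ∀ hs : s ∈ p.dom, π (q s) = p.toFun ⟨s, hs⟩ := by
  obtain ⟨P, hP, h, hPp, -⟩ := exists_pushVec_eq_plotVec p
  obtain ⟨q, hq, hqe, hqP⟩ := hπ.exists_lift hP h
  refine ⟨q, hq, hqe, ?_⟩
  filter_upwards [hPp, hqP] with s h1 h2 hs
  rw [← h1 hs]
  exact h2

theorem IsDiffeologicalBundle.tangentMap_surjective (hπ : IsDiffeologicalBundle F₀ π) (e : E) :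
    Function.Surjective (tangentMap π hπ.smooth e) := by
  intro z
  induction z using tangent_induction with
  | zero => exact ⟨0, map_zero _⟩
  | push p v =>
    obtain ⟨q, hq, hqe, hqp⟩ := hπ.exists_lift_pointedPlot p
    refine ⟨plotVec q hq 0 hqe v, ?_⟩
    rw [tangentMap_plotVec _ _ hq _ (hq.dSmooth_comp hπ.smooth) (congrArg π hqe)]
    exact (pushVec_eq_plotVec p _ hqp _ v).symm
  | add z w hz hw =>
    obtain ⟨a, rfl⟩ := hz
    obtain ⟨b, rfl⟩ := hw
    exact ⟨a + b, map_add _ _ _⟩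

/-- A morphism of pointed plots, extended from a neighbourhood of `0` to a smooth map on all of the
Euclidean space. -/
lemma PointedPlot.IsHom.exists_contDiff {b : B} {p p' : PointedPlot B b} {f : Euc p.dim → Euc p'.dim}
    (hf : p.IsHom p' f) : ∃ g : Euc p.dim → Euc p'.dim, ContDiff ℝ ∞ g ∧ g =ᶠ[𝓝 0] f ∧
      g 0 = 0 ∧ HasFDerivAt g (fderiv ℝ f 0) 0 := by
  have hdom := p.isOpen_dom.mem_nhds p.zero_mem
  obtain ⟨χ, hχ, hχU, hχt⟩ := exists_contDiff_eventuallyEq_id hdom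
  have hgf : f ∘ χ =ᶠ[𝓝 0] f := hχt.fun_comp f
  have hd : DifferentiableAt ℝ f 0 := (hf.contDiffOn.contDiffAt hdom).differentiableAt (by simp)
  exact ⟨f ∘ χ, hf.contDiffOn.comp_contDiff hχ hχU, hgf, hgf.eq_of_nhds.trans hf.map_zero,
    hd.hasFDerivAt.congr_of_eventuallyEq hgf⟩

/-- Lifting pointed plots of `B` to `E` is compatible with morphisms, modulo vectors tangent to the
fiber. -/
lemma IsDiffeologicalBundle.mkQ_plotVec_lift (hπ : IsDiffeologicalBundle F₀ π) {e : E}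
    {p p' : PointedPlot B (π e)} {f : Euc p.dim → Euc p'.dim} (hf : p.IsHom p' f)
    {q : Euc p.dim → E} (hq : IsPlot q) (hqe : q 0 = e)
    (hqp : ∀ᶠ s in 𝓝 0, ∀ hs : s ∈ p.dom, π (q s) = p.toFun ⟨s, hs⟩)
    {q' : Euc p'.dim → E} (hq' : IsPlot q') (hqe' : q' 0 = e)
    (hqp' : ∀ᶠ s in 𝓝 0, ∀ hs : s ∈ p'.dom, π (q' s) = p'.toFun ⟨s, hs⟩) (v : Euc p.dim) :
    (LinearMap.range (fiberTangentMap π e)).mkQ (plotVec q' hq' 0 hqe' (fderiv ℝ f 0 v)) =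
      (LinearMap.range (fiberTangentMap π e)).mkQ (plotVec q hq 0 hqe v) := by
  obtain ⟨g, hg, hgf, hg0, hD⟩ := hf.exists_contDiff
  have hqg : IsPlot (q' ∘ g) := isPlot_reparam hq' hg
  have hqg0 : (q' ∘ g) 0 = e := (congrArg q' hg0).trans hqe'
  rw [← plotVec_comp hq' hg hqg hg0 hD hqg0 hqe']
  refine hπ.mkQ_plotVec_eq hqg hq ?_ hqg0 hqe v
  have hcont : Tendsto g (𝓝 0) (𝓝 0) := by
    have := hg.continuous.tendsto 0
    rwa [hg0] at this
  filter_upwards [hqp, hcont.eventually hqp', hgf, p.isOpen_dom.mem_nhds p.zero_mem]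
    with s h1 h2 h3 hs
  rw [h3] at h2
  calc π (q' (g s)) = π (q' (f s)) := by rw [h3]
    _ = _ := h2 (hf.mapsTo hs)
    _ = _ := hf.comm ⟨s, hs⟩
    _ = π (q s) := (h1 hs).symm

lemma tangentMap_tangentMap_of_const {X : Type u} {Y : Type v} {Z : Type w}
    [DiffeologicalSpace X] [DiffeologicalSpace Y] [DiffeologicalSpace Z] {f : X → Y} {g : Y → Z}
    (hf : DSmooth f) (hg : DSmooth g) {x : X} (h : ∀ y, g (f y) = g (f x))
    (z : TangentSpaceAt X x) : tangentMap g hg (f x) (tangentMap f hf x z) = 0 := by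
  induction z using tangent_induction with
  | zero => rw [map_zero, map_zero]
  | push p v =>
    refine (congrArg (tangentMap g hg (f x)) (tangentMap_pushVec f hf p v)).trans
      ((tangentMap_pushVec g hg (p.map f hf) v).trans ?_)
    exact pushVec_eq_zero_of_const ((p.map f hf).map g hg) (fun s => h (p.toFun s)) v
  | add z w hz hw => rw [map_add, map_add, hz, hw, add_zero]

/-- Lifting pointed plots along `π` defines a map `T_b(B) → T_e(E) / ι_* T_e(F)`, whose composite
with `π_*` is the quotient map. -/
lemma IsDiffeologicalBundle.exists_leftInverse (hπ : IsDiffeologicalBundle F₀ π) (e : E) :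
    ∃ D : TangentSpaceAt B (π e) →ₗ[ℝ] TangentSpaceAt E e ⧸ LinearMap.range (fiberTangentMap π e),
      ∀ z, D (tangentMap π hπ.smooth e z) = (LinearMap.range (fiberTangentMap π e)).mkQ z := by
  choose q hq hqe hqp using fun p : PointedPlot B (π e) => hπ.exists_lift_pointedPlot p
  let D := tangentDesc
    (fun p => (LinearMap.range (fiberTangentMap π e)).mkQ.comp (plotVec (q p) (hq p) 0 (hqe p)))
    (fun p p' f hf v => hπ.mkQ_plotVec_lift hf (hq p) (hqe p) (hqp p) (hq p') (hqe p') (hqp p') v)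
  have hD : D.comp (tangentMap π hπ.smooth e) = (LinearMap.range (fiberTangentMap π e)).mkQ := by
    refine tangent_hom_ext fun p v => ?_
    obtain ⟨P, hP, h, hPp, hpP⟩ := exists_pushVec_eq_plotVec p
    refine (congrArg D (tangentMap_pushVec π hπ.smooth p v)).trans
      ((tangentDesc_pushVec _ _ _ _).trans ?_)
    rw [hpP]
    refine hπ.mkQ_plotVec_eq (hq (p.map π hπ.smooth)) hP ?_ (hqe _) h v
    filter_upwards [hPp, hqp (p.map π hπ.smooth), p.isOpen_dom.mem_nhds p.zero_mem]
      with s h1 h2 hs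
    exact (h2 hs).trans (congrArg π (h1 hs)).symm
  exact ⟨D, LinearMap.congr_fun hD⟩

theorem IsDiffeologicalBundle.tangentMap_exact (hπ : IsDiffeologicalBundle F₀ π) (e : E) :
    Function.Exact (fiberTangentMap π e) (tangentMap π hπ.smooth e) := by
  obtain ⟨D, hD⟩ := hπ.exists_leftInverse e
  intro z
  refine ⟨fun hz => ?_, ?_⟩
  · have h1 := hD z
    rw [hz, map_zero] at h1
    exact (Submodule.Quotient.mk_eq_zero _).1 h1.symm
  · rintro ⟨y, rfl⟩
    exact tangentMap_tangentMap_of_const (dSmooth_subtype_val fun y => π y = π e) hπ.smooth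
      (fun y => y.2) y

end Bundles

/-! ### Plots of the tangent bundle and their lifts -/

section GermDiffeology

variable {Z : Type u}

/-- The diffeology whose plots are the maps that have, at each point, the germ of a map in the
class `C`. The class has to contain the constants and to be stable under smooth
reparametrizations. -/
@[reducible]
def germDiffeology (C : ∀ n : ℕ, (Euc n → Z) → Prop) (hconst : ∀ n z, C n fun _ => z)
    (hcomp : ∀ (n m : ℕ) (p : Euc n → Z) (f : Euc m → Euc n), C n p → ContDiff ℝ ∞ f →
      C m (p ∘ f)) : DiffeologicalSpace Z where
  plots n := {p | ∀ t, ∃ q, C n q ∧ p =ᶠ[𝓝 t] q}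
  constant_plots z _ := ⟨_, hconst _ z, EventuallyEq.rfl⟩
  plot_reparam {n m p f} hp hf t := by
    obtain ⟨q, hq, hpq⟩ := hp (f t)
    exact ⟨q ∘ f, hcomp _ _ _ _ hq hf, hf.continuous.continuousAt.eventually hpq⟩
  locality {n p} h t := by
    obtain ⟨U, hU, ht, hp⟩ := h t
    obtain ⟨χ, hχ, hχU, hχt⟩ := exists_contDiff_eventuallyEq_id (hU.mem_nhds ht)
    obtain ⟨q, hq, hpq⟩ := hp hχU hχ t
    exact ⟨q, hq, (hχt.fun_comp p).symm.trans hpq⟩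

end GermDiffeology

section Elementary

variable {X : Type u} [DiffeologicalSpace X] {n m : ℕ}

/-- The family of vectors `v s` at the points `c s` is of the form `TP (u s, w s)`, for a plot `P`
and smooth maps `u` and `w`. -/
def IsElementary (c : Euc n → X) (v : ∀ s, TangentSpaceAt X (c s)) : Prop :=
  ∃ (k : ℕ) (P : Euc k → X) (hP : IsPlot P) (u w : Euc n → Euc k), ContDiff ℝ ∞ u ∧
    ContDiff ℝ ∞ w ∧ ∀ s, ∃ h : P (u s) = c s, v s = plotVec P hP (u s) h (w s)

/-- The family of vectors `v s` at the points `c s` is a finite sum of elementary families along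
the same map `c`. -/
inductive IsElementarySum (c : Euc n → X) : (∀ s, TangentSpaceAt X (c s)) → Prop
  | zero : IsElementarySum c fun _ => 0
  | add (v w : ∀ s, TangentSpaceAt X (c s)) : IsElementary c v → IsElementarySum c w →
      IsElementarySum c fun s => v s + w s

lemma sigma_plotVec_eq {P : Euc n → X} (hP : IsPlot P) {t : Euc n} {x : X} (h : P t = x)
    (v : Euc n) :
    (⟨x, plotVec P hP t h v⟩ : TangentTotal X) = ⟨P t, plotVec P hP t rfl v⟩ := by
  subst h
  rfl

namespace IsElementary

variable {c : Euc n → X} {v : ∀ s, TangentSpaceAt X (c s)}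

lemma comp (h : IsElementary c v) {f : Euc m → Euc n} (hf : ContDiff ℝ ∞ f) :
    IsElementary (fun s => c (f s)) fun s => v (f s) := by
  obtain ⟨k, P, hP, u, w, hu, hw, h⟩ := h
  exact ⟨k, P, hP, u ∘ f, w ∘ f, hu.comp hf, hw.comp hf, fun s => h (f s)⟩

lemma isPlot_base (h : IsElementary c v) : IsPlot c := by
  obtain ⟨k, P, hP, u, w, hu, hw, h⟩ := h
  have : c = P ∘ u := funext fun s => (h s).1.symm
  rw [this]
  exact isPlot_reparam hP hu

lemma smul (h : IsElementary c v) {a : Euc n → ℝ} (ha : ContDiff ℝ ∞ a) :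
    IsElementary c fun s => a s • v s := by
  obtain ⟨k, P, hP, u, w, hu, hw, h⟩ := h
  refine ⟨k, P, hP, u, fun s => a s • w s, hu, ha.smul hw, fun s => ?_⟩
  obtain ⟨hs, hv⟩ := h s
  exact ⟨hs, (congrArg (a s • ·) hv).trans (map_smul _ _ _).symm⟩

lemma isElementarySum (h : IsElementary c v) : IsElementarySum c v := by
  simpa using IsElementarySum.add v _ h .zero

lemma const {x : X} (p : PointedPlot X x) (v : Euc p.dim) :
    IsElementary (fun _ : Euc n => x) fun _ => pushVec p v := by
  obtain ⟨P, hP, h, -, hv⟩ := exists_pushVec_eq_plotVec p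
  exact ⟨_, P, hP, fun _ => 0, fun _ => v, contDiff_const, contDiff_const, fun _ => ⟨h, hv v⟩⟩

lemma map {Y : Type v} [DiffeologicalSpace Y] {f : X → Y} (hf : DSmooth f)
    (h : IsElementary c v) :
    IsElementary (fun s => f (c s)) fun s => tangentMap f hf (c s) (v s) := by
  obtain ⟨k, P, hP, u, w, hu, hw, h⟩ := h
  refine ⟨k, f ∘ P, hP.dSmooth_comp hf, u, w, hu, hw, fun s => ?_⟩
  obtain ⟨hs, hv⟩ := h s
  exact ⟨congrArg f hs,
    (congrArg (tangentMap f hf (c s)) hv).trans (tangentMap_plotVec f hf hP hs _ _ _)⟩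

lemma isPlot_hector (h : IsElementary c v) :
    @IsPlot _ (hectorDiffeology X) _ fun s => (⟨c s, v s⟩ : TangentTotal X) := by
  obtain ⟨k, P, hP, u, w, hu, hw, h⟩ := h
  rw [DiffeologicalSpace.isPlot_sInf_iff]
  intro d hd
  have hPU : DSmooth fun s : (Set.univ : Set (Euc k)) => P s :=
    hP.dSmooth.comp (dSmooth_subtype_val _)
  have := hd k Set.univ isOpen_univ isConnected_univ (fun s => P s) hPU n
    (fun s => (⟨u s, trivial⟩, w s)) ⟨hu.isPlot, hw.isPlot⟩
  have e : (fun s => (⟨c s, v s⟩ : TangentTotal X)) =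
      plotTangent isOpen_univ isConnected_univ (fun s : (Set.univ : Set (Euc k)) => P s) hPU ∘
        fun s => (⟨u s, trivial⟩, w s) := by
    funext s
    obtain ⟨hs, hv⟩ := h s
    exact (congrArg (Sigma.mk (c s)) hv).trans (sigma_plotVec_eq hP hs (w s))
  rw [e]
  exact this

end IsElementary

namespace IsElementarySum

variable {c : Euc n → X} {v w : ∀ s, TangentSpaceAt X (c s)}

lemma comp (h : IsElementarySum c v) {f : Euc m → Euc n} (hf : ContDiff ℝ ∞ f) :
    IsElementarySum (fun s => c (f s)) fun s => v (f s) := by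
  induction h with
  | zero => exact .zero
  | add v w hv _ ih => exact .add _ _ (hv.comp hf) ih

lemma add' (hv : IsElementarySum c v) (hw : IsElementarySum c w) :
    IsElementarySum c fun s => v s + w s := by
  induction hv with
  | zero => simpa using hw
  | add v v' hv _ ih =>
    simp only [add_assoc]
    exact .add _ _ hv ih

lemma smul (h : IsElementarySum c v) {a : Euc n → ℝ} (ha : ContDiff ℝ ∞ a) :
    IsElementarySum c fun s => a s • v s := by
  induction h with
  | zero => simpa using IsElementarySum.zero
  | add v w hv _ ih =>
    simp only [smul_add]
    exact .add _ _ (hv.smul ha) ih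

lemma const {x : X} (z : TangentSpaceAt X x) :
    IsElementarySum (fun _ : Euc n => x) fun _ => z := by
  induction z using tangent_induction with
  | zero => exact .zero
  | push p v => exact (IsElementary.const p v).isElementarySum
  | add z w hz hw => exact hz.add' hw

lemma map {Y : Type v} [DiffeologicalSpace Y] {f : X → Y} (hf : DSmooth f)
    (h : IsElementarySum c v) :
    IsElementarySum (fun s => f (c s)) fun s => tangentMap f hf (c s) (v s) := by
  induction h with
  | zero => simpa using IsElementarySum.zero
  | add v w hv _ ih =>
    simp only [map_add]
    exact .add _ _ (hv.map hf) ih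

lemma isPlot_dvs (hc : IsPlot c) (h : IsElementarySum c v) :
    @IsPlot _ (dvsDiffeology X) _ fun s => (⟨c s, v s⟩ : TangentTotal X) := by
  rw [DiffeologicalSpace.isPlot_sInf_iff]
  rintro d ⟨hd, hdvs⟩
  induction h with
  | zero => exact hdvs.smooth_zero n c hc
  | add v w hv _ ih =>
    exact hdvs.smooth_add n (fun s => ⟨c s, v s, w s⟩)
      ⟨DiffeologicalSpace.le_iff'.1 hd n _ hv.isPlot_hector, ih⟩

end IsElementarySum

end Elementary

section BundleDiffeologies

variable (X : Type u) [DiffeologicalSpace X]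

/-- The diffeology on the tangent bundle whose plots are locally constant or elementary. -/
@[reducible]
def elementaryDiffeology : DiffeologicalSpace (TangentTotal X) :=
  germDiffeology (fun _ h => (∃ z, h = fun _ => z) ∨
      IsElementary (fun s => (h s).1) fun s => (h s).2)
    (fun _ z => .inl ⟨z, rfl⟩)
    (by
      rintro n m p f (⟨z, rfl⟩ | h) hf
      · exact .inl ⟨z, rfl⟩
      · exact .inr (h.comp hf))

/-- The diffeology on the tangent bundle whose plots are locally finite sums of elementary families
of vectors, along a plot of the base. Constants are such sums, as the vectors of plots span the
tangent spaces. -/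
@[reducible]
def elementarySumDiffeology : DiffeologicalSpace (TangentTotal X) :=
  germDiffeology (fun _ h => IsPlot (fun s => (h s).1) ∧
      IsElementarySum (fun s => (h s).1) fun s => (h s).2)
    (fun _ z => ⟨isPlot_const, .const z.2⟩)
    (fun _ _ _ _ h hf => ⟨isPlot_reparam h.1 hf, h.2.comp hf⟩)

variable {X}

/-- On a connected open set, `Tp` agrees locally with `TP` for a plot `P` on all of `ℝⁿ`. -/
lemma plotTangent_eq {n : ℕ} {U : Set (Euc n)} (hU : IsOpen U) (hUc : IsConnected U) {p : U → X}
    (hp : DSmooth p) {P : Euc n → X} (hP : IsPlot P) {t : Euc n} (ht : t ∈ U)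
    (hPp : ∀ᶠ s in 𝓝 t, ∀ hs : s ∈ U, P s = p ⟨s, hs⟩) (h : P t = p ⟨t, ht⟩) (v : Euc n) :
    plotTangent hU hUc p hp (⟨t, ht⟩, v) = ⟨p ⟨t, ht⟩, plotVec P hP t h v⟩ := by
  have hadd : ContDiff ℝ ∞ fun s : Euc n => t + s := contDiff_const.add contDiff_id
  have hP' : IsPlot (P ∘ fun s => t + s) := isPlot_reparam hP hadd
  have h' : (P ∘ fun s => t + s) 0 = p ⟨t, ht⟩ := by simpa using h
  have hT : Tendsto (fun s : Euc n => t + s) (𝓝 0) (𝓝 t) := by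
    simpa using hadd.continuous.tendsto 0
  have hd : HasFDerivAt (fun s : Euc n => t + s) (ContinuousLinearMap.id ℝ (Euc n)) 0 :=
    (hasFDerivAt_id (0 : Euc n)).const_add t
  have e1 := pushVec_eq_plotVec (PointedPlot.translate hU hUc p hp ⟨t, ht⟩) hP'
    ((hT.eventually hPp).mono fun s hs hs' => hs hs') h' v
  have e2 := plotVec_comp hP hadd hP' (add_zero t) hd h' h v
  exact congrArg (Sigma.mk (p ⟨t, ht⟩)) (e1.trans e2)

/-- The generators of Hector's diffeology are locally elementary. -/
lemma exists_isElementary_plotTangent {n k : ℕ} {U : Set (Euc k)} (hU : IsOpen U)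
    (hUc : IsConnected U) {p : U → X} (hp : DSmooth p) {z : Euc n → U × Euc k} (hz : IsPlot z)
    (t : Euc n) : ∃ q : Euc n → TangentTotal X, IsElementary (fun s => (q s).1) (fun s => (q s).2) ∧
      plotTangent hU hUc p hp ∘ z =ᶠ[𝓝 t] q := by
  have hu : ContDiff ℝ ∞ fun s => ((z s).1 : Euc k) :=
    IsPlot.contDiff (p := fun s => ((z s).1 : Euc k)) hz.1
  have hw : ContDiff ℝ ∞ fun s => (z s).2 := IsPlot.contDiff (p := fun s => (z s).2) hz.2
  obtain ⟨P, hP, hPp⟩ := exists_isPlot_extending hU hp (z t).1.2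
  obtain ⟨χ, hχ, hχU, hχt⟩ := exists_contDiff_eventuallyEq_id
    (hu.continuous.continuousAt.eventually hPp.eventually_nhds)
  refine ⟨fun s => plotTangent hU hUc p hp (z (χ s)), ⟨k, P, hP, fun s => (z (χ s)).1,
    fun s => (z (χ s)).2, hu.comp hχ, hw.comp hχ, fun s => ?_⟩, ?_⟩
  · have h : P (z (χ s)).1 = p (z (χ s)).1 := (hχU s).self_of_nhds (z (χ s)).1.2
    have := plotTangent_eq hU hUc hp hP (z (χ s)).1.2 (hχU s) h (z (χ s)).2
    exact ⟨h, eq_of_heq (Sigma.mk.inj_iff.1 this).2⟩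
  · filter_upwards [hχt] with s hs
    simp [hs]

lemma hectorDiffeology_le : hectorDiffeology X ≤ elementaryDiffeology X := by
  refine sInf_le fun k U hU hUc p hp n z hz t => ?_
  obtain ⟨q, hq, hqz⟩ := exists_isElementary_plotTangent hU hUc hp hz t
  exact ⟨q, .inr hq, hqz⟩

lemma hectorDiffeology_le_elementarySum : hectorDiffeology X ≤ elementarySumDiffeology X := by
  refine sInf_le fun k U hU hUc p hp n z hz t => ?_
  obtain ⟨q, hq, hqz⟩ := exists_isElementary_plotTangent hU hUc hp hz t
  exact ⟨q, ⟨hq.isPlot_base, hq.isElementarySum⟩, hqz⟩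

lemma isDVSOver_elementarySumDiffeology :
    IsDVSOver (TangentSpaceAt X) (elementarySumDiffeology X) where
  smooth_proj n p hp := by
    refine isPlot_of_eventuallyEq fun t => ?_
    obtain ⟨q, hq, hpq⟩ := hp t
    exact ⟨_, hq.1, hpq.fun_comp Sigma.fst⟩
  smooth_add n p hp t := by
    obtain ⟨q₁, hq₁, hpq₁⟩ := hp.1 t
    obtain ⟨q₂, hq₂, hpq₂⟩ := hp.2 t
    obtain ⟨χ, hχ, hχU, hχt⟩ := exists_contDiff_eventuallyEq_id (inter_mem hpq₁ hpq₂)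
    -- After composition with `χ` the two germs are global and have the same base points.
    have e₁ : q₁ ∘ χ = fun s => ⟨(p (χ s)).1, (p (χ s)).2.1⟩ := funext fun s => (hχU s).1.symm
    have e₂ : q₂ ∘ χ = fun s => ⟨(p (χ s)).1, (p (χ s)).2.2⟩ := funext fun s => (hχU s).2.symm
    have h₁ : IsPlot (fun s => ((q₁ ∘ χ) s).1) ∧
        IsElementarySum (fun s => ((q₁ ∘ χ) s).1) fun s => ((q₁ ∘ χ) s).2 :=
      ⟨isPlot_reparam hq₁.1 hχ, hq₁.2.comp hχ⟩
    have h₂ : IsElementarySum (fun s => ((q₂ ∘ χ) s).1) fun s => ((q₂ ∘ χ) s).2 := hq₂.2.comp hχ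
    rw [e₁] at h₁
    rw [e₂] at h₂
    refine ⟨fun s => ⟨(p (χ s)).1, (p (χ s)).2.1 + (p (χ s)).2.2⟩, ⟨h₁.1, h₁.2.add' h₂⟩, ?_⟩
    filter_upwards [hχt] with s hs
    exact congrArg (fun r => (⟨(p r).1, (p r).2.1 + (p r).2.2⟩ : TangentTotal X)) hs.symm
  smooth_smul n p hp t := by
    obtain ⟨q, hq, hpq⟩ := hp.2 t
    have ha : ContDiff ℝ ∞ fun s => (p s).1 := IsPlot.contDiff (p := fun s => (p s).1) hp.1
    refine ⟨fun s => ⟨(q s).1, (p s).1 • (q s).2⟩, ⟨hq.1, hq.2.smul ha⟩, ?_⟩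
    filter_upwards [hpq] with s hs
    simp only [Function.comp_apply] at hs ⊢
    rw [hs]
  smooth_zero n p hp t := ⟨_, ⟨hp, .zero⟩, EventuallyEq.rfl⟩

lemma dvsDiffeology_le : dvsDiffeology X ≤ elementarySumDiffeology X :=
  sInf_le ⟨hectorDiffeology_le_elementarySum, isDVSOver_elementarySumDiffeology⟩

lemma isPlot_hectorFiber {x : X} {n : ℕ} {p : Euc n → TangentSpaceAt X x}
    (hp : IsElementary (fun _ => x) p) : @IsPlot _ (hectorFiber X x) n p :=
  hp.isPlot_hector

lemma isPlot_dvsFiber {x : X} {n : ℕ} {p : Euc n → TangentSpaceAt X x}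
    (hp : IsElementarySum (fun _ => x) p) : @IsPlot _ (dvsFiber X x) n p :=
  hp.isPlot_dvs isPlot_const

lemma exists_isElementary_of_isPlot {x : X} {n : ℕ} {p : Euc n → TangentSpaceAt X x}
    (hp : @IsPlot _ (hectorFiber X x) n p) (t : Euc n) :
    ∃ q, q =ᶠ[𝓝 t] p ∧ ((∃ z, q = fun _ => z) ∨ IsElementary (fun _ => x) q) := by
  obtain ⟨q, hq, hpq⟩ := DiffeologicalSpace.le_iff'.1 hectorDiffeology_le n _ hp t
  obtain ⟨χ, hχ, hχU, hχt⟩ := exists_contDiff_eventuallyEq_id hpq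
  refine ⟨p ∘ χ, hχt.fun_comp p, ?_⟩
  have e : q ∘ χ = fun s => ⟨x, p (χ s)⟩ := funext fun s => (hχU s).symm
  obtain ⟨z, rfl⟩ | hq := hq
  · exact .inl ⟨p (χ t), funext fun s => eq_of_heq (Sigma.mk.inj_iff.1
      ((congrFun e s).symm.trans (congrFun e t))).2⟩
  · have h : IsElementary (fun s => ((q ∘ χ) s).1) fun s => ((q ∘ χ) s).2 := hq.comp hχ
    rw [e] at h
    exact .inr h

lemma exists_isElementarySum_of_isPlot {x : X} {n : ℕ} {p : Euc n → TangentSpaceAt X x}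
    (hp : @IsPlot _ (dvsFiber X x) n p) (t : Euc n) :
    ∃ q, q =ᶠ[𝓝 t] p ∧ IsElementarySum (fun _ => x) q := by
  obtain ⟨q, hq, hpq⟩ := DiffeologicalSpace.le_iff'.1 dvsDiffeology_le n _ hp t
  obtain ⟨χ, hχ, hχU, hχt⟩ := exists_contDiff_eventuallyEq_id hpq
  have e : q ∘ χ = fun s => ⟨x, p (χ s)⟩ := funext fun s => (hχU s).symm
  have h : IsElementarySum (fun s => ((q ∘ χ) s).1) fun s => ((q ∘ χ) s).2 := hq.2.comp hχ
  rw [e] at h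
  exact ⟨p ∘ χ, hχt.fun_comp p, h⟩

variable {Y : Type v} [DiffeologicalSpace Y]

lemma dSmooth_tangentMap_hector {f : X → Y} (hf : DSmooth f) (x : X) :
    @DSmooth _ _ (hectorFiber X x) (hectorFiber Y (f x)) (tangentMap f hf x) := by
  intro n p hp
  refine @isPlot_of_eventuallyEq _ (hectorFiber Y (f x)) _ _ fun t => ?_
  obtain ⟨q, hqp, hq⟩ := exists_isElementary_of_isPlot hp t
  refine ⟨tangentMap f hf x ∘ q, ?_, (hqp.fun_comp _).symm⟩
  obtain ⟨z, rfl⟩ | hq := hq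
  · exact @isPlot_const _ (hectorFiber Y (f x)) _ _
  · exact isPlot_hectorFiber (hq.map hf)

lemma dSmooth_tangentMap_dvs {f : X → Y} (hf : DSmooth f) (x : X) :
    @DSmooth _ _ (dvsFiber X x) (dvsFiber Y (f x)) (tangentMap f hf x) := by
  intro n p hp
  refine @isPlot_of_eventuallyEq _ (dvsFiber Y (f x)) _ _ fun t => ?_
  obtain ⟨q, hqp, hq⟩ := exists_isElementarySum_of_isPlot hp t
  exact ⟨tangentMap f hf x ∘ q, isPlot_dvsFiber (hq.map hf), (hqp.fun_comp _).symm⟩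

end BundleDiffeologies

section Lifting

variable {E : Type u} {B : Type v} {F₀ : Type w} [DiffeologicalSpace E] [DiffeologicalSpace B]
  [DiffeologicalSpace F₀] {π : E → B}

/-- Elementary families of vectors at `π e` lift locally to elementary families at `e`. If
`r s = TP (u s, w s)` with `P (u s) = π e`, then the vectors `(0, w s)` at the points `(s, u s)` are
pushed forward along the plot `(s, x) ↦ ψ x (γ (u s) e)` over `P`, which sends all the points
`(s, u s)` to `e`. -/
lemma IsDiffeologicalBundle.exists_isElementary_lift (hπ : IsDiffeologicalBundle F₀ π) {e : E}
    {n : ℕ} {r : Euc n → TangentSpaceAt B (π e)} (hr : IsElementary (fun _ => π e) r)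
    (t : Euc n) : ∃ q, IsElementary (fun _ => e) q ∧
      ∀ᶠ s in 𝓝 t, tangentMap π hπ.smooth e (q s) = r s := by
  obtain ⟨k, P, hP, u, w, hu, hw, hr⟩ := hr
  obtain ⟨χ, ψ, γ, hχ, hχt, hψ, hπψ, hγ, hψγ⟩ := hπ.exists_trivialization hP (hr t).1
  obtain ⟨χ', hχ', hχU, hχt'⟩ := exists_contDiff_eventuallyEq_id
    (hu.continuous.continuousAt.eventually hχt.eventually_nhds)
  have hu' : ContDiff ℝ ∞ fun s => u (χ' s) := hu.comp hχ'
  have hχu : ∀ s, χ (u (χ' s)) = u (χ' s) := fun s => (hχU s).self_of_nhds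
  have hPe : ∀ s, P (χ (u (χ' s))) = π e := fun s => by rw [hχu]; exact (hr _).1
  have hg : IsPlot fun s => γ (u (χ' s)) e := hγ n _ (fun _ => e) hu' isPlot_const hPe
  let L := eucSum n k
  have hQ : IsPlot fun z : Euc (n + k) => ψ (L z).2 (γ (u (χ' (L z).1)) e) :=
    hψ _ _ _ (contDiff_snd.comp L.contDiff) (isPlot_reparam hg (contDiff_fst.comp L.contDiff))
  have hQe : ∀ s, ψ (L (L.symm (s, u (χ' s)))).2 (γ (u (χ' (L (L.symm (s, u (χ' s)))).1)) e) = e :=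
    fun s => by
      rw [L.apply_symm_apply]
      exact hψγ _ _ (hPe s)
  refine ⟨fun s => plotVec _ hQ (L.symm (s, u (χ' s))) (hQe s) (L.symm (0, w (χ' s))),
    ⟨n + k, _, hQ, fun s => L.symm (s, u (χ' s)), fun s => L.symm (0, w (χ' s)),
      L.symm.contDiff.comp (contDiff_id.prodMk hu'),
      L.symm.contDiff.comp (contDiff_const.prodMk (hw.comp hχ')), fun s => ⟨hQe s, rfl⟩⟩, ?_⟩
  filter_upwards [hχt'] with s hs
  obtain ⟨h, hv⟩ := hr (χ' s)
  rw [tangentMap_plotVec π hπ.smooth hQ (hQe s) (hQ.dSmooth_comp hπ.smooth) (congrArg π (hQe s))]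
  refine Eq.trans ?_ (hv.symm.trans (congrArg r hs))
  let A : Euc (n + k) →L[ℝ] Euc k := (ContinuousLinearMap.snd ℝ _ _).comp L.toContinuousLinearMap
  have hA : A (L.symm (s, u (χ' s))) = u (χ' s) := by simp [A]
  have hd : HasFDerivAt (fun z => χ (A z)) A (L.symm (s, u (χ' s))) := by
    have h1 : HasFDerivAt χ (ContinuousLinearMap.id ℝ _) (A (L.symm (s, u (χ' s)))) := by
      rw [hA]
      exact (hasFDerivAt_id _).congr_of_eventuallyEq (hχU s)
    exact h1.comp _ A.hasFDerivAt
  rw [plotVec_eq hP (hQ.dSmooth_comp hπ.smooth) (f := fun z => χ (A z)) (hχ.comp A.contDiff)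
    (by rw [hA, hχu]) hd (Eventually.of_forall fun z => hπψ _ _) (congrArg π (hQe s)) h]
  simp [A]

lemma IsDiffeologicalBundle.exists_isElementarySum_lift (hπ : IsDiffeologicalBundle F₀ π) {e : E}
    {n : ℕ} {r : Euc n → TangentSpaceAt B (π e)} (hr : IsElementarySum (fun _ => π e) r)
    (t : Euc n) : ∃ q, IsElementarySum (fun _ => e) q ∧
      ∀ᶠ s in 𝓝 t, tangentMap π hπ.smooth e (q s) = r s := by
  induction hr with
  | zero => exact ⟨_, .zero, Eventually.of_forall fun s => map_zero _⟩
  | add v w hv _ ih =>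
    obtain ⟨q₁, hq₁, h₁⟩ := hπ.exists_isElementary_lift hv t
    obtain ⟨q₂, hq₂, h₂⟩ := ih
    refine ⟨_, .add _ _ hq₁ hq₂, ?_⟩
    filter_upwards [h₁, h₂] with s hs₁ hs₂
    rw [map_add, hs₁, hs₂]

theorem IsDiffeologicalBundle.isSubduction_tangentMap_hector (hπ : IsDiffeologicalBundle F₀ π)
    (e : E) : @IsSubduction _ _ (hectorFiber E e) (hectorFiber B (π e))
      (tangentMap π hπ.smooth e) := by
  refine @isSubduction_of_lift _ (hectorFiber E e) _ (hectorFiber B (π e)) _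
    (dSmooth_tangentMap_hector hπ.smooth e) fun n p hp t => ?_
  obtain ⟨r, hrp, ⟨z, rfl⟩ | hr⟩ := exists_isElementary_of_isPlot hp t
  · obtain ⟨y, rfl⟩ := hπ.tangentMap_surjective e z
    exact ⟨fun _ => y, @isPlot_const _ (hectorFiber E e) _ _, hrp⟩
  · obtain ⟨q, hq, hqr⟩ := hπ.exists_isElementary_lift hr t
    exact ⟨q, isPlot_hectorFiber hq, EventuallyEq.trans hqr hrp⟩

theorem IsDiffeologicalBundle.isSubduction_tangentMap_dvs (hπ : IsDiffeologicalBundle F₀ π)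
    (e : E) : @IsSubduction _ _ (dvsFiber E e) (dvsFiber B (π e))
      (tangentMap π hπ.smooth e) := by
  refine @isSubduction_of_lift _ (dvsFiber E e) _ (dvsFiber B (π e)) _
    (dSmooth_tangentMap_dvs hπ.smooth e) fun n p hp t => ?_
  obtain ⟨r, hrp, hr⟩ := exists_isElementarySum_of_isPlot hp t
  obtain ⟨q, hq, hqr⟩ := hπ.exists_isElementarySum_lift hr t
  exact ⟨q, isPlot_dvsFiber hq, EventuallyEq.trans hqr hrp⟩

end Lifting

end Diffeology

end

theorem theorem3p2 {E : Type*} {B : Type*} {F₀ : Type*} [DiffeologicalSpace E]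
    [DiffeologicalSpace B] [DiffeologicalSpace F₀] (π : E → B)
    (hπ : Diffeology.IsDiffeologicalBundle F₀ π) (e : E) :
    Function.Exact
        (Diffeology.tangentMap (Subtype.val : {y : E // π y = π e} → E)
          (Diffeology.dSmooth_subtype_val fun y => π y = π e) ⟨e, rfl⟩)
        (Diffeology.tangentMap π hπ.smooth e) ∧
      Function.Surjective (Diffeology.tangentMap π hπ.smooth e) ∧
      @Diffeology.IsSubduction _ _ (Diffeology.hectorFiber E e) (Diffeology.hectorFiber B (π e))
        (Diffeology.tangentMap π hπ.smooth e) ∧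
      @Diffeology.IsSubduction _ _ (Diffeology.dvsFiber E e) (Diffeology.dvsFiber B (π e))
        (Diffeology.tangentMap π hπ.smooth e) := by
  exact ⟨hπ.tangentMap_exact e, hπ.tangentMap_surjective e, hπ.isSubduction_tangentMap_hector e,
    hπ.isSubduction_tangentMap_dvs e⟩
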